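/- Let $\mathcal K$ be a locally presentable category and let $\mathcal A$ be a full subcategory of $\mathcal K$. An \emph{$\mathcal A$-precover} (or weak coreflection to $\mathcal A$) of an object $K$ of $\mathcal K$ is a morphism $c\colon X\to K$ with $X\in\mathcal A$ such that every morphism $f\colon A\to K$ with $A\in\mathcal A$ factors, not necessarily uniquely, through $c$. An $\mathcal A$-precover $c\colon X\to K$ is an \emph{$\mathcal A$-cover} if every morphism $h\colon X\to X$ with $c\circ h=c$ is an isomorphism. The subcategory $\mathcal A$ is \emph{weakly coreflective} (respectively, \emph{stably weakly coreflective}) if every object of $\mathcal K$ has an $\mathcal A$-precover (respectively, an $\mathcal A$-cover). Suppose that $\mathcal A$ is weakly coreflective and closed under directed colimits in $\mathcal K$. Then $\mathcal A$ is stably weakly coreflective. Moreover, every precover can be refined to a cover: for every $\mathcal A$-precover $c\colon X\to K$ there are an $\mathcal A$-cover $c'\colon Y\to K$ and morphisms $i\colon Y\to X$ and $r\colon X\to Y$ such that $r\circ i=\mathrm{id}_Y$, $c\circ i=c'$ and $c'\circ r=c$. -/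

import Mathlib

universe w v u

namespace CategoryTheory.ObjectProperty

variable {C : Type u} [Category.{v} C]

/-- The full subcategory of `C` on the objects satisfying `A` is closed under directed colimits:
any colimit in `C` of a diagram in `A` indexed by a (small, nonempty) directed poset lies in
`A`. -/
def IsClosedUnderDirectedColimits (A : ObjectProperty C) : Prop :=
  ∀ (J : Type w) [PartialOrder J] [IsDirectedOrder J] [Nonempty J],
    A.IsClosedUnderColimitsOfShape J

/-- A morphism `c : X ⟶ K` is an `A`-precover (a weak coreflection of `K` to `A`) if `X` is in `A`
and any morphism to `K` from an object in `A` factors, not necessarily uniquely, through `c`. -/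
structure IsPrecover (A : ObjectProperty C) {X K : C} (c : X ⟶ K) : Prop where
  mem : A X
  exists_fac : ∀ ⦃Y : C⦄, A Y → ∀ f : Y ⟶ K, ∃ g : Y ⟶ X, g ≫ c = f

/-- An `A`-precover `c : X ⟶ K` is an `A`-cover (a stable weak coreflection of `K` to `A`) if any
endomorphism `h` of `X` whose composite with `c` is `c` is an isomorphism. -/
structure IsCover (A : ObjectProperty C) {X K : C} (c : X ⟶ K) : Prop extends
    A.IsPrecover c where
  isIso_of_fac : ∀ h : X ⟶ X, h ≫ c = c → IsIso h

/-- `A` is weakly coreflective if any object has an `A`-precover. -/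
def IsWeaklyCoreflective (A : ObjectProperty C) : Prop :=
  ∀ K : C, ∃ (X : C) (c : X ⟶ K), A.IsPrecover c

/-- `A` is stably weakly coreflective if any object has an `A`-cover. -/
def IsStablyWeaklyCoreflective (A : ObjectProperty C) : Prop :=
  ∀ K : C, ∃ (X : C) (c : X ⟶ K), A.IsCover c

end CategoryTheory.ObjectProperty

/-! Let `D` be the category of objects of `A` over `K`; it has colimits of chains. A precover is a
weakly terminal object of `D`, a cover one whose endomorphisms are all invertible. Let `U` send an
object to its set of generalized elements from a strong generator of `κ`-presentable objects: `U` is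
conservative, and elements of colimits of `κ`-chains lift to some stage. Two cardinality arguments
carry the proof. Every object maps to some `N` all of whose outgoing morphisms are `U`-injective
(`exists_hom_forall_injective`). If `N` is weakly terminal, its endomorphisms are also
`U`-surjective (`surjective_map_endomorphism`), hence invertible. -/

namespace CategoryTheory

open Limits

section Iteration

variable {D : Type u} [Category.{v} D]

/-- A category with colimits of chains has iterations of any nonempty well-ordered shape. -/
lemma hasIterationOfShape_of_linearOrder
    (hD : ∀ (J : Type w) [LinearOrder J] [Nonempty J], HasColimitsOfShape J D)
    (J : Type w) [LinearOrder J] [Nonempty J] : HasIterationOfShape J D where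
  hasColimitsOfShape_of_isSuccLimit _ hj :=
    have := hj.nonempty_Iio.to_subtype
    hD _
  hasColimitsOfShape := hD J

/-- If any object is the source of a morphism in `W`, then there are diagrams of shape any
well-ordered type whose successor steps belong to `W`. -/
lemma MorphismProperty.exists_functor_map_succ_mem (W : MorphismProperty D) (X₀ : D)
    (hW : ∀ Y : D, ∃ (Z : D) (g : Y ⟶ Z), W g)
    (J : Type w) [LinearOrder J] [OrderBot J] [SuccOrder J] [NoMaxOrder J] [WellFoundedLT J]
    [HasIterationOfShape J D] :
    ∃ (F : J ⥤ D) (_ : X₀ ≅ F.obj ⊥), ∀ j : J, W (F.map (homOfLE (Order.le_succ j))) := by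
  choose s t ht using hW
  let Φ : SmallObject.SuccStruct D := { X₀ := X₀, succ := s, toSucc := t }
  refine ⟨Φ.iterationFunctor J, (Φ.iterationFunctorObjBotIso J).symm, fun j ↦ ?_⟩
  have hΦ : Φ.prop ≤ W := by
    rintro _ _ _ ⟨⟩
    exact ht _
  exact hΦ _ (Φ.prop_iterationFunctor_map_succ j (not_isMax j))

end Iteration

section Stabilization

variable {D : Type u} [Category.{v} D] (U : D ⥤ Type w)

/-- A morphism `f : X ⟶ Y` is `U`-stable if postcomposing `f` with any morphism does not identify
more elements of `U.obj X` than `f` does. -/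
def IsStableFor : MorphismProperty D := fun X Y f ↦
  ∀ ⦃Z : D⦄ (g : Y ⟶ Z) (x y : U.obj X), U.map (f ≫ g) x = U.map (f ≫ g) y → U.map f x = U.map f y

variable (hD : ∀ (J : Type w) [LinearOrder J] [Nonempty J], HasColimitsOfShape J D)

include hD

/-- Otherwise one could keep identifying new pairs of elements of `U.obj X` along a chain longer
than the number of such pairs. -/
lemma exists_isStableFor (X : D) : ∃ (Y : D) (f : X ⟶ Y), IsStableFor U f := by
  by_contra! h
  let W : MorphismProperty (Under X) := fun Y Z _ ↦
    ∃ x y : U.obj X, U.map Y.hom x ≠ U.map Y.hom y ∧ U.map Z.hom x = U.map Z.hom y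
  have hW (Y : Under X) : ∃ (Z : Under X) (g : Y ⟶ Z), W g := by
    have := h _ Y.hom
    simp only [IsStableFor, not_forall] at this
    obtain ⟨Z, g, x, y, h₁, h₂⟩ := this
    exact ⟨Under.mk (Y.hom ≫ g), Under.homMk g, x, y, h₂, h₁⟩
  obtain ⟨μ, hμ, hX⟩ := HasCardinalLT.exists_regular_cardinal.{w} (U.obj X × U.obj X)
  have : Nonempty μ.ord.ToType := by simpa using hμ.ne_zero
  have := Cardinal.noMaxOrder hμ.aleph0_le
  let := WellFoundedLT.toOrderBot μ.ord.ToType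
  let := SuccOrder.ofLinearWellFoundedLT μ.ord.ToType
  have : HasIterationOfShape μ.ord.ToType (Under X) :=
    hasIterationOfShape_of_linearOrder (fun J _ _ ↦ by
      -- Colimits in `Under X` come from `D` only for connected shapes, which nonempty chains are.
      have := hD J
      have := IsFiltered.isConnected J
      infer_instance) _
  obtain ⟨F, -, hF⟩ := W.exists_functor_map_succ_mem (Under.mk (𝟙 X)) hW μ.ord.ToType
  choose x y hne heq using hF
  have key {j j' : μ.ord.ToType} (hj : j < j') :
      U.map (F.obj j').hom (x j) = U.map (F.obj j').hom (y j) := by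
    rw [← Under.w (F.map (homOfLE (Order.succ_le_of_lt hj)))]
    simp only [Functor.map_comp, types_comp_apply]
    exact congrArg _ (heq j)
  -- A pair identified at stage `j + 1` remains so, hence cannot be new at a later stage.
  have hinj : Function.Injective (fun j ↦ (x j, y j)) := by
    intro j j' hjj'
    obtain ⟨hx, hy⟩ := Prod.ext_iff.1 hjj'
    dsimp at hx hy
    rcases lt_trichotomy j j' with hj | hj | hj
    · exact (hne j' (by rw [← hx, ← hy]; exact key hj)).elim
    · exact hj
    · exact (hne j (by rw [hx, hy]; exact key hj)).elim
  have := hX.of_injective _ hinj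
  simp [hasCardinalLT_iff_cardinal_mk_lt] at this

/-- Assume that elements of the values of `U` on colimits of shape a regular cardinal `κ` lift to
some stage. Then any object maps to an object all of whose outgoing morphisms are sent by `U` to
injections. -/
lemma exists_hom_forall_injective (κ : Cardinal.{w}) [hκ : Fact κ.IsRegular]
    (hU : ∀ ⦃F : κ.ord.ToType ⥤ D⦄ ⦃c : Cocone F⦄ (_ : IsColimit c) (x : U.obj c.pt),
      ∃ (j : κ.ord.ToType) (y : U.obj (F.obj j)), U.map (c.ι.app j) y = x) (X : D) :
    ∃ (Y : D) (_ : X ⟶ Y), ∀ ⦃Z : D⦄ (g : Y ⟶ Z), Function.Injective (U.map g) := by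
  have : Nonempty κ.ord.ToType := by simpa using hκ.out.ne_zero
  have := Cardinal.noMaxOrder hκ.out.aleph0_le
  let := WellFoundedLT.toOrderBot κ.ord.ToType
  let := SuccOrder.ofLinearWellFoundedLT κ.ord.ToType
  have := hasIterationOfShape_of_linearOrder hD κ.ord.ToType
  obtain ⟨F, e, hF⟩ := MorphismProperty.exists_functor_map_succ_mem (IsStableFor U) X
    (exists_isStableFor U hD) κ.ord.ToType
  refine ⟨colimit F, e.hom ≫ colimit.ι F ⊥, fun Z g x y hxy ↦ ?_⟩
  have lift (j j' : κ.ord.ToType) (hj : j ≤ j') (z : U.obj (F.obj j)) :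
      U.map (colimit.ι F j) z = U.map (colimit.ι F j') (U.map (F.map (homOfLE hj)) z) := by
    rw [← types_comp_apply (U.map _) (U.map _), ← U.map_comp, colimit.w]
  obtain ⟨j₁, x, rfl⟩ := hU (colimit.isColimit F) x
  obtain ⟨j₂, y, rfl⟩ := hU (colimit.isColimit F) y
  dsimp at hxy ⊢
  -- Move both elements to one stage `j`; stability of the step from `j` to `j + 1` then identifies
  -- them before the colimit.
  rw [lift _ _ (le_max_left j₁ j₂), lift _ _ (le_max_right j₁ j₂)] at hxy ⊢
  generalize U.map (F.map (homOfLE (le_max_left j₁ j₂))) x = x at hxy ⊢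
  generalize U.map (F.map (homOfLE (le_max_right j₁ j₂))) y = y at hxy ⊢
  generalize max j₁ j₂ = j at x y hxy ⊢
  have := hF j (colimit.ι F _ ≫ g) x y (by simpa using hxy)
  rw [lift j _ (Order.le_succ j), lift j _ (Order.le_succ j), this]

/-- If `M` is weakly terminal and `U` sends all morphisms from `M` to injections, then `U` sends
all endomorphisms of `M` to surjections. -/
lemma surjective_map_endomorphism {M : D} (hM : ∀ X : D, Nonempty (X ⟶ M))
    (hM' : ∀ ⦃Z : D⦄ (g : M ⟶ Z), Function.Injective (U.map g)) (h : M ⟶ M) :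
    Function.Surjective (U.map h) := by
  by_contra hh
  let W : MorphismProperty D := fun Y Z f ↦ ¬ Function.Surjective (U.map f) ∧
    ∀ ⦃T : D⦄ (g : Z ⟶ T), Function.Injective (U.map g)
  have hW (Y : D) : ∃ (Z : D) (g : Y ⟶ Z), W g := by
    obtain ⟨t⟩ := hM Y
    refine ⟨M, t ≫ h, fun hs ↦ hh fun x ↦ ?_, hM'⟩
    obtain ⟨y, rfl⟩ := hs x
    exact ⟨U.map t y, by simp⟩
  obtain ⟨μ, hμ, hX⟩ := HasCardinalLT.exists_regular_cardinal.{w} (U.obj M)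
  have : Nonempty μ.ord.ToType := by simpa using hμ.ne_zero
  have := Cardinal.noMaxOrder hμ.aleph0_le
  let := WellFoundedLT.toOrderBot μ.ord.ToType
  let := SuccOrder.ofLinearWellFoundedLT μ.ord.ToType
  have := hasIterationOfShape_of_linearOrder hD μ.ord.ToType
  obtain ⟨F, -, hF⟩ := W.exists_functor_map_succ_mem M hW μ.ord.ToType
  obtain ⟨t⟩ := hM (colimit F)
  have hne (j : μ.ord.ToType) : ∃ x : U.obj (F.obj (Order.succ j)),
      ∀ y, U.map (F.map (homOfLE (Order.le_succ j))) y ≠ x := by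
    simpa [Function.Surjective] using (hF j).1
  choose x hx using hne
  -- `x j'` is outside the image of stage `j'`, which contains the image of `x j`; morphisms out of
  -- stage `j' + 1` are `U`-injective, so the two stay distinct in `U.obj M`.
  have key {j j' : μ.ord.ToType} (hj : j < j') :
      U.map (colimit.ι F _ ≫ t) (x j) ≠ U.map (colimit.ι F _ ≫ t) (x j') := by
    intro heq
    refine hx j' (U.map (F.map (homOfLE (Order.succ_le_of_lt hj))) (x j))
      ((hF j').2 (colimit.ι F _ ≫ t) ?_)
    rw [← heq]
    simp only [← ConcreteCategory.comp_apply, ← Functor.map_comp, colimit.w_assoc]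
  have hinj : Function.Injective (fun j ↦ U.map (colimit.ι F _ ≫ t) (x j)) := by
    intro j j' hjj'
    rcases lt_trichotomy j j' with hj | hj | hj
    · exact (key hj hjj').elim
    · exact hj
    · exact (key hj hjj'.symm).elim
  have := hX.of_injective _ hinj
  simp [hasCardinalLT_iff_cardinal_mk_lt] at this

/-- A category with colimits of chains which has a weakly terminal object and a suitable
conservative functor to types has a weakly terminal object all of whose endomorphisms are
isomorphisms. -/
lemma exists_weaklyTerminal_forall_isIso [U.ReflectsIsomorphisms]
    (κ : Cardinal.{w}) [Fact κ.IsRegular]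
    (hU : ∀ ⦃F : κ.ord.ToType ⥤ D⦄ ⦃c : Cocone F⦄ (_ : IsColimit c) (x : U.obj c.pt),
      ∃ (j : κ.ord.ToType) (y : U.obj (F.obj j)), U.map (c.ι.app j) y = x)
    {M : D} (hM : ∀ X : D, Nonempty (X ⟶ M)) :
    ∃ N : D, (∀ X : D, Nonempty (X ⟶ N)) ∧ ∀ h : N ⟶ N, IsIso h := by
  obtain ⟨N, f, hN⟩ := exists_hom_forall_injective U hD κ hU M
  have hN' (X : D) : Nonempty (X ⟶ N) := ⟨(hM X).some ≫ f⟩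
  refine ⟨N, hN', fun h ↦ ?_⟩
  have : IsIso (U.map h) :=
    (isIso_iff_bijective _).2 ⟨hN h, surjective_map_endomorphism U hD hN' hN h⟩
  exact isIso_of_reflects_iso h U

end Stabilization

section Generator

variable {C : Type u} [Category.{w} C] {ι : Type w} (G : ι → C)

/-- The functor sending `X` to the set of morphisms to `X` from the objects of the family `G`. -/
def generalizedElements : C ⥤ Type w where
  obj X := Σ i, G i ⟶ X
  map f := ↾fun x ↦ ⟨x.1, x.2 ≫ f⟩

/-- Injectivity makes `f` mono, since `G` separates; surjectivity lifts every morphism from a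
generator through `f`, which forces a mono to be invertible. -/
lemma generalizedElements_reflectsIsomorphisms
    (hG : (ObjectProperty.ofObj G).IsStrongGenerator) :
    (generalizedElements G).ReflectsIsomorphisms where
  reflects {X Y} f _ := by
    have hf : Function.Bijective ((generalizedElements G).map f) :=
      (isIso_iff_bijective _).1 inferInstance
    have : Mono f := ⟨fun {Z} a b hab ↦ hG.isSeparating _ _ (by
      rintro _ ⟨i⟩ g
      have : (generalizedElements G).map f ⟨i, g ≫ a⟩ =
          (generalizedElements G).map f ⟨i, g ≫ b⟩ :=
        Sigma.ext rfl (heq_of_eq (show (g ≫ a) ≫ f = (g ≫ b) ≫ f by simp [hab]))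
      exact eq_of_heq (Sigma.mk.inj (hf.1 this)).2)⟩
    refine hG.isIso_of_mono f ?_
    rintro _ ⟨i⟩ g
    obtain ⟨⟨j, g'⟩, hg⟩ := hf.2 ⟨i, g⟩
    obtain rfl : j = i := congrArg Sigma.fst hg
    exact ⟨g', eq_of_heq (Sigma.mk.inj hg).2⟩

lemma generalizedElements_jointly_surjective (κ : Cardinal.{w}) [Fact κ.IsRegular]
    [∀ i, IsCardinalPresentable (G i) κ]
    {J : Type w} [SmallCategory J] [IsCardinalFiltered J κ] {F : J ⥤ C} {c : Cocone F}
    (hc : IsColimit c) (x : (generalizedElements G).obj c.pt) :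
    ∃ (j : J) (y : (generalizedElements G).obj (F.obj j)),
      (generalizedElements G).map (c.ι.app j) y = x := by
  obtain ⟨i, x⟩ := x
  obtain ⟨j, y, rfl⟩ := IsCardinalPresentable.exists_hom_of_isColimit κ hc x
  exact ⟨j, ⟨i, y⟩, rfl⟩

end Generator

namespace ObjectProperty

variable {C : Type u} [Category.{w} C] (A : ObjectProperty C)

lemma exists_isCover [IsLocallyPresentable.{w} C]
    (hA' : IsClosedUnderDirectedColimits.{w} A) {X K : C} {c : X ⟶ K} (hc : A.IsPrecover c) :
    ∃ (Y : C) (c' : Y ⟶ K), A.IsCover c' := by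
  obtain ⟨κ, _, _⟩ := IsLocallyPresentable.exists_cardinal.{w} C
  obtain ⟨P, _, hP⟩ := HasCardinalFilteredGenerator.exists_small_generator C κ
  let G (i : Shrink.{w} (Subtype P)) : C := ((equivShrink _).symm i).1
  have hPG : ofObj G = P := by
    ext Z
    refine ⟨?_, fun hZ ↦ ?_⟩
    · rintro ⟨i⟩
      exact ((equivShrink _).symm i).2
    · simpa [G] using ofObj_apply G (equivShrink _ ⟨Z, hZ⟩)
  have hG (i : Shrink.{w} (Subtype P)) : IsCardinalPresentable (G i) κ :=
    hP.le_isCardinalPresentable _ ((equivShrink _).symm i).2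
  have := generalizedElements_reflectsIsomorphisms G (by
    rw [hPG]
    exact hP.isStrongGenerator)
  let Q : ObjectProperty (Over K) := A.inverseImage (Over.forget K)
  have hQ (J : Type w) [LinearOrder J] [Nonempty J] : Q.IsClosedUnderColimitsOfShape J :=
    have := hA' J
    inferInstance
  have : Nonempty κ.ord.ToType := by
    simpa using (Fact.out : κ.IsRegular).ne_zero
  obtain ⟨N, hN, hN'⟩ := exists_weaklyTerminal_forall_isIso
    (D := Q.FullSubcategory) (Q.ι ⋙ Over.forget K ⋙ generalizedElements G)
    (fun J _ _ ↦ inferInstance) κ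
    (fun F c hc x ↦ generalizedElements_jointly_surjective G κ
      (isColimitOfPreserves (Q.ι ⋙ Over.forget K) hc) x)
    (M := ⟨Over.mk c, hc.mem⟩) (fun Z ↦ by
      obtain ⟨g, hg⟩ := hc.exists_fac Z.property Z.obj.hom
      exact ⟨homMk (Over.homMk g hg)⟩)
  refine ⟨N.obj.left, N.obj.hom, ⟨N.property, fun Y hY f ↦ ?_⟩, fun h fac ↦ ?_⟩
  · obtain ⟨g⟩ := hN ⟨Over.mk f, hY⟩
    exact ⟨g.hom.left, Over.w g.hom⟩
  · have := hN' (homMk (Over.homMk h fac))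
    exact inferInstanceAs (IsIso ((Q.ι ⋙ Over.forget K).map (homMk (Over.homMk h fac) : N ⟶ N)))

variable {A} in
lemma IsCover.exists_retract {X Y K : C} {c : X ⟶ K} {c' : Y ⟶ K}
    (hc' : A.IsCover c') (hc : A.IsPrecover c) :
    ∃ (i : Y ⟶ X) (r : X ⟶ Y), i ≫ r = 𝟙 Y ∧ i ≫ c = c' ∧ r ≫ c' = c := by
  obtain ⟨f, hf⟩ := hc.exists_fac hc'.mem c'
  obtain ⟨r, hr⟩ := hc'.exists_fac hc.mem c
  have : IsIso (f ≫ r) := hc'.isIso_of_fac _ (by simp [hf, hr])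
  -- The endomorphism `f ≫ r` lies over `K`, so its inverse does too; precomposing with it makes `f`
  -- a section of `r`.
  exact ⟨inv (f ≫ r) ≫ f, r, by simp, by simp [hf, hr], hr⟩

end ObjectProperty

end CategoryTheory

open CategoryTheory in
theorem mainTheorem2 {C : Type u} [Category.{w} C] [IsLocallyPresentable.{w} C]
    (A : ObjectProperty C) (hA : A.IsWeaklyCoreflective)
    (hA' : ObjectProperty.IsClosedUnderDirectedColimits.{w} A) :
    A.IsStablyWeaklyCoreflective ∧
      ∀ ⦃X K : C⦄ (c : X ⟶ K), A.IsPrecover c →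
        ∃ (Y : C) (c' : Y ⟶ K) (i : Y ⟶ X) (r : X ⟶ Y),
          A.IsCover c' ∧ i ≫ r = 𝟙 Y ∧ i ≫ c = c' ∧ r ≫ c' = c := by
  refine ⟨fun K ↦ ?_, fun X K c hc ↦ ?_⟩
  · obtain ⟨X, c, hc⟩ := hA K
    exact A.exists_isCover hA' hc
  · obtain ⟨Y, c', hc'⟩ := A.exists_isCover hA' hc
    obtain ⟨i, r, h₁, h₂, h₃⟩ := hc'.exists_retract hc
    exact ⟨Y, c', i, r, hc', h₁, h₂, h₃⟩
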